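/- Let $I=[0,1]$, let $\lambda$ be Lebesgue measure, and let $N\ge 1$ be an integer. For $1\le d\le N$ let $T_d:I\to I$, $T_d(x)=(d+1)x \pmod 1$ (with values in $[0,1)$). For a word $w=(w_1w_2\cdots w_n)$ of length $|w|=n$ with letters in $\{1,\dots,N\}$ put $T_w=T_{w_n}\circ\cdots\circ T_{w_1}$ (the identity for the empty word), $\mathscr O_w(f)=f\circ T_w$, and define the $n$-th order ergodic sum of $f:I\to\mathbb R$ along $w$ by $$f^n_w \;=\; f+\mathscr O_{(w_1)}(f)+\mathscr O_{(w_1w_2)}(f)+\cdots+\mathscr O_{(w_1w_2\cdots w_{n-1})}(f).$$ **Theorem (Ergodicity, simultaneous action).** For every real-valued Lebesgue integrable function $f\in L^1(\lambda)$ on $I$ and for $\lambda$-almost every $x\in I$, $$\lim_{n\to\infty}\ \frac1n\,\frac1{N^n}\sum_{w\,:\,|w|=n} f^n_w(x)\;=\;\int_0^1 f\,d\lambda .$$ -/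

import Mathlib

open MeasureTheory Filter Topology

noncomputable section

/-- The interval map `T_d : [0,1] → [0,1]`, `T_d x = (d + 1) x (mod 1)`. -/
def intervalMap (d : ℕ) (x : unitInterval) : unitInterval :=
  ⟨Int.fract (((d : ℝ) + 1) * (x : ℝ)), Int.fract_nonneg _, (Int.fract_lt_one _).le⟩

/-- The alphabet `{1, …, N}`. -/
abbrev Letter (N : ℕ) : Type := ↥(Finset.Icc 1 N)

/-- `T_w = T_{w_n} ∘ ⋯ ∘ T_{w_1}` for a word `w = (w_1 ⋯ w_n)`: the first letter acts first. For the
empty word it is the identity. -/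
def wordMap {N : ℕ} : {n : ℕ} → (Fin n → Letter N) → unitInterval → unitInterval
  | 0, _ => id
  | n + 1, w => intervalMap (w (Fin.last n) : ℕ) ∘ wordMap (fun i : Fin n => w i.castSucc)

/-- The composition operator `O_w f = f ∘ T_w`. -/
def compOp {N n : ℕ} (w : Fin n → Letter N) (f : unitInterval → ℝ) : unitInterval → ℝ :=
  f ∘ wordMap w

/-- The `n`-th order ergodic sum
`f^n_w = f + O_{(w_1)} f + O_{(w_1 w_2)} f + ⋯ + O_{(w_1 ⋯ w_{n-1})} f`
of `f` along the `n`-lettered word `w`; `Fin.take k _ w` is the prefix of `w` of length `k`. -/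
def ergodicSum {N n : ℕ} (w : Fin n → Letter N) (f : unitInterval → ℝ) (x : unitInterval) : ℝ :=
  ∑ k : Fin n, compOp (Fin.take (k : ℕ) k.isLt.le w) f x

end

/-! Let P be the average of the operators f ↦ f ∘ T_d over the N letters. Averaging f ∘ T_w over all
words of length k gives P^k f, and every word of length k is a prefix of equally many words of
length n. The quantity in the theorem is therefore (1/n) ∑_{k<n} P^k f, and the claim is a pointwise
ergodic theorem for P. That theorem (`ae_tendsto_koopmanSum`) combines a maximal inequality with a
dense class. Hopf's lemma gives a weak type (1,1) bound for the averages. For a constant plus a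
bounded coboundary g - P g the sums telescope and converge everywhere. Such functions are dense in
L¹ by the mean ergodic theorem in L²: a vector fixed by P is fixed by each composition operator,
hence is constant because one T_d is ergodic. Ergodicity of T_d comes from multiplication by d + 1
on the circle. -/

noncomputable section

/-! ### Averaged composition operators and the maximal inequality. -/

section AveragedKoopman

variable {α ι : Type*} [Fintype ι]

/-- The average of the composition operators `f ↦ f ∘ T i` of a finite family of self-maps. -/
def averagedKoopman (T : ι → α → α) : Module.End ℝ (α → ℝ) :=
  (Fintype.card ι : ℝ)⁻¹ • ∑ i, LinearMap.funLeft ℝ ℝ (T i)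

theorem averagedKoopman_apply (T : ι → α → α) (f : α → ℝ) (x : α) :
    averagedKoopman T f x = (Fintype.card ι : ℝ)⁻¹ * ∑ i, f (T i x) := by
  simp [averagedKoopman, LinearMap.funLeft_apply, LinearMap.sum_apply]

theorem averagedKoopman_mono (T : ι → α → α) : Monotone (averagedKoopman T) := by
  intro f g h x
  rw [averagedKoopman_apply, averagedKoopman_apply]
  gcongr with i
  exact h _

theorem averagedKoopman_const [Nonempty ι] (T : ι → α → α) (c : ℝ) :
    averagedKoopman T (fun _ => c) = fun _ => c := by
  ext x
  rw [averagedKoopman_apply]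
  have : (Fintype.card ι : ℝ) ≠ 0 := by simp
  simp [this]

theorem averagedKoopman_pow_mono (T : ι → α → α) (k : ℕ) : Monotone (averagedKoopman T ^ k) := by
  intro f g h
  rw [Module.End.pow_apply, Module.End.pow_apply]
  exact (averagedKoopman_mono T).iterate k h

theorem averagedKoopman_pow_const [Nonempty ι] (T : ι → α → α) (c : ℝ) (k : ℕ) :
    (averagedKoopman T ^ k) (fun _ => c) = fun _ => c := by
  rw [Module.End.pow_apply]
  exact Function.iterate_fixed (averagedKoopman_const T c) k

/-- The sum of the first `n` iterates of the averaged composition operator. -/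
def koopmanSum (T : ι → α → α) (n : ℕ) : Module.End ℝ (α → ℝ) :=
  ∑ k ∈ Finset.range n, averagedKoopman T ^ k

theorem koopmanSum_apply (T : ι → α → α) (n : ℕ) (f : α → ℝ) :
    koopmanSum T n f = ∑ k ∈ Finset.range n, (averagedKoopman T ^ k) f := by
  simp [koopmanSum, LinearMap.sum_apply]

theorem koopmanSum_succ' (T : ι → α → α) (n : ℕ) (f : α → ℝ) :
    koopmanSum T (n + 1) f = f + averagedKoopman T (koopmanSum T n f) := by
  rw [koopmanSum_apply, koopmanSum_apply, Finset.sum_range_succ', map_sum, add_comm]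
  simp [pow_succ']

theorem koopmanSum_mono (T : ι → α → α) (n : ℕ) : Monotone (koopmanSum T n) := by
  intro f g h
  rw [koopmanSum_apply, koopmanSum_apply]
  exact Finset.sum_le_sum fun k _ => averagedKoopman_pow_mono T k h

theorem koopmanSum_const [Nonempty ι] (T : ι → α → α) (n : ℕ) (c : ℝ) :
    koopmanSum T n (fun _ => c) = fun _ => n * c := by
  ext x
  simp [koopmanSum_apply, averagedKoopman_pow_const]

theorem koopmanSum_sub_averagedKoopman (T : ι → α → α) (n : ℕ) (g : α → ℝ) :
    koopmanSum T n (g - averagedKoopman T g) = g - (averagedKoopman T ^ n) g := by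
  have := geom_sum_mul_neg (averagedKoopman T) n
  exact congrArg (fun A : Module.End ℝ (α → ℝ) => A g) this

theorem sub_averagedKoopman_koopmanSum (T : ι → α → α) (n : ℕ) (g : α → ℝ) :
    koopmanSum T n g - averagedKoopman T (koopmanSum T n g) = g - (averagedKoopman T ^ n) g := by
  have := mul_neg_geom_sum (averagedKoopman T) n
  exact congrArg (fun A : Module.End ℝ (α → ℝ) => A g) this

theorem abs_averagedKoopman_pow_le [Nonempty ι] (T : ι → α → α) {f : α → ℝ} {C : ℝ}
    (h : ∀ x, |f x| ≤ C) (k : ℕ) (x : α) : |(averagedKoopman T ^ k) f x| ≤ C := by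
  rw [abs_le]
  constructor
  · have := averagedKoopman_pow_mono T k (a := fun _ => -C) (b := f) (fun y => (abs_le.1 (h y)).1) x
    rwa [averagedKoopman_pow_const] at this
  · have := averagedKoopman_pow_mono T k (a := f) (b := fun _ => C) (fun y => (abs_le.1 (h y)).2) x
    rwa [averagedKoopman_pow_const] at this

theorem abs_koopmanSum_le [Nonempty ι] (T : ι → α → α) {f : α → ℝ} {C : ℝ}
    (h : ∀ x, |f x| ≤ C) (n : ℕ) (x : α) : |koopmanSum T n f x| ≤ n * C := by
  rw [koopmanSum_apply, Finset.sum_apply]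
  refine (Finset.abs_sum_le_sum_abs _ _).trans
    ((Finset.sum_le_sum fun k _ => abs_averagedKoopman_pow_le T h k x).trans ?_)
  simp

theorem abs_koopmanSum_le_koopmanSum_abs (T : ι → α → α) (f : α → ℝ) (n : ℕ) (x : α) :
    |koopmanSum T n f x| ≤ koopmanSum T n |f| x := by
  rw [abs_le]
  constructor
  · have := koopmanSum_mono T n (a := -|f|) (b := f) (fun y => neg_abs_le (f y)) x
    rwa [map_neg] at this
  · exact koopmanSum_mono T n (le_abs_self f) x

/-- The running maximum of the sums `koopmanSum T k f`, defined recursively. -/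
def koopmanMax (T : ι → α → α) (f : α → ℝ) : ℕ → α → ℝ
  | 0 => 0
  | n + 1 => 0 ⊔ (f + averagedKoopman T (koopmanMax T f n))

theorem koopmanMax_nonneg (T : ι → α → α) (f : α → ℝ) (n : ℕ) : 0 ≤ koopmanMax T f n := by
  cases n
  · exact le_rfl
  · exact le_sup_left

theorem koopmanMax_mono (T : ι → α → α) (f : α → ℝ) : Monotone (koopmanMax T f) := by
  refine monotone_nat_of_le_succ fun n => ?_
  induction n with
  | zero => exact koopmanMax_nonneg T f 1
  | succ n ih =>
    exact sup_le_sup_left (add_le_add_right (averagedKoopman_mono T ih) f) 0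

/-- Since P of a maximum dominates the maximum of the P's, `koopmanMax` may exceed the true running
maximum; this upper bound is all the weak type inequality needs. -/
theorem koopmanSum_le_koopmanMax (T : ι → α → α) (f : α → ℝ) (n : ℕ) :
    koopmanSum T n f ≤ koopmanMax T f n := by
  induction n with
  | zero => simp [koopmanSum, koopmanMax]
  | succ n ih =>
    rw [koopmanSum_succ']
    exact le_sup_of_le_right (add_le_add_right (averagedKoopman_mono T ih) f)

variable [MeasurableSpace α] {μ : Measure α} {T : ι → α → α}

theorem MeasureTheory.MemLp.averagedKoopman {p : ENNReal} {f : α → ℝ} (hf : MemLp f p μ)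
    (hT : ∀ i, MeasurePreserving (T i) μ μ) : MemLp (averagedKoopman T f) p μ := by
  have h : MemLp (fun x => ∑ i, f (T i x)) p μ :=
    memLp_finsetSum _ fun i _ => hf.comp_measurePreserving (hT i)
  convert! h.const_mul (Fintype.card ι : ℝ)⁻¹ using 1
  ext x
  exact averagedKoopman_apply T f x

theorem MeasureTheory.Integrable.averagedKoopman {f : α → ℝ} (hf : Integrable f μ)
    (hT : ∀ i, MeasurePreserving (T i) μ μ) : Integrable (averagedKoopman T f) μ :=
  memLp_one_iff_integrable.1 ((memLp_one_iff_integrable.2 hf).averagedKoopman hT)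

theorem MeasureTheory.MemLp.averagedKoopman_pow {p : ENNReal} {f : α → ℝ} (hf : MemLp f p μ)
    (hT : ∀ i, MeasurePreserving (T i) μ μ) (k : ℕ) : MemLp ((_root_.averagedKoopman T ^ k) f) p μ := by
  induction k with
  | zero => simpa using hf
  | succ k ih =>
    rw [pow_succ']
    exact ih.averagedKoopman hT

theorem MeasureTheory.MemLp.koopmanSum {p : ENNReal} {f : α → ℝ} (hf : MemLp f p μ)
    (hT : ∀ i, MeasurePreserving (T i) μ μ) (n : ℕ) : MemLp (koopmanSum T n f) p μ := by
  rw [koopmanSum_apply]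
  exact memLp_finsetSum' _ fun k _ => hf.averagedKoopman_pow hT k

theorem integral_averagedKoopman [Nonempty ι] {f : α → ℝ} (hf : Integrable f μ)
    (hT : ∀ i, MeasurePreserving (T i) μ μ) : ∫ x, averagedKoopman T f x ∂μ = ∫ x, f x ∂μ := by
  have h (i : ι) : ∫ x, f (T i x) ∂μ = ∫ x, f x ∂μ := by
    conv_rhs => rw [← (hT i).map_eq]
    refine (integral_map (hT i).aemeasurable ?_).symm
    rw [(hT i).map_eq]
    exact hf.1
  have : (Fintype.card ι : ℝ) ≠ 0 := by simp
  simp_rw [averagedKoopman_apply]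
  rw [integral_const_mul, integral_finsetSum (f := fun i x => f (T i x)) _
    fun i _ => (hT i).integrable_comp_of_integrable hf]
  simp [h, this]

theorem integrable_koopmanMax {f : α → ℝ} (hf : Integrable f μ)
    (hT : ∀ i, MeasurePreserving (T i) μ μ) (n : ℕ) : Integrable (koopmanMax T f n) μ := by
  induction n with
  | zero => exact integrable_zero _ _ _
  | succ n ih => exact (integrable_zero _ _ _).sup (hf.add (ih.averagedKoopman hT))

/-- **Hopf's maximal ergodic lemma** for the averaged composition operator. -/
theorem setIntegral_koopmanMax_pos_nonneg [Nonempty ι] {f : α → ℝ} (hf : Integrable f μ)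
    (hT : ∀ i, MeasurePreserving (T i) μ μ) (n : ℕ) :
    0 ≤ ∫ x in {x | 0 < koopmanMax T f n x}, f x ∂μ := by
  obtain _ | n := n
  · simp [koopmanMax]
  set M := koopmanMax T f (n + 1) with hM
  have hMi : Integrable M μ := integrable_koopmanMax hf hT _
  have hPi : Integrable (averagedKoopman T M) μ := hMi.averagedKoopman hT
  have hs : NullMeasurableSet {x | 0 < M x} μ :=
    nullMeasurableSet_lt aemeasurable_const hMi.1.aemeasurable
  have hM0 : 0 ≤ M := koopmanMax_nonneg T f _
  have hP0 : 0 ≤ averagedKoopman T M := by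
    simpa using averagedKoopman_mono T hM0
  -- Where M > 0, the recursion gives M = f + P M_n ≤ f + P M. Restricting to this set loses nothing
  -- of ∫ M and can only decrease ∫ P M, while ∫ P M = ∫ M.
  have h1 : ∫ x in {x | 0 < M x}, (M x - averagedKoopman T M x) ∂μ
      ≤ ∫ x in {x | 0 < M x}, f x ∂μ := by
    refine setIntegral_mono_on₀ (hMi.sub hPi).integrableOn hf.integrableOn hs fun x hx => ?_
    have h2 : koopmanMax T f n ≤ M := koopmanMax_mono T f n.le_succ
    have h3 := averagedKoopman_mono T h2 x
    have h4 : M x = 0 ⊔ (f x + averagedKoopman T (koopmanMax T f n) x) := rfl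
    have h5 : 0 < M x := hx
    rcases le_total 0 (f x + averagedKoopman T (koopmanMax T f n) x) with h | h
    · rw [sup_eq_right.2 h] at h4
      linarith
    · rw [sup_eq_left.2 h] at h4
      linarith
  have h2 : ∫ x in {x | 0 < M x}, M x ∂μ = ∫ x, M x ∂μ :=
    setIntegral_eq_integral_of_forall_compl_eq_zero fun x hx =>
      le_antisymm (not_lt.1 hx) (hM0 x)
  have h3 : ∫ x in {x | 0 < M x}, averagedKoopman T M x ∂μ ≤ ∫ x, averagedKoopman T M x ∂μ :=
    setIntegral_le_integral hPi (Eventually.of_forall hP0)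
  rw [integral_sub hMi.integrableOn hPi.integrableOn] at h1
  have := integral_averagedKoopman hMi hT
  linarith

/-- The weak type `(1, 1)` maximal inequality for the averaged composition operator. -/
theorem measure_exists_lt_abs_koopmanSum_le [Nonempty ι] [IsFiniteMeasure μ] {f : α → ℝ}
    (hf : Integrable f μ) (hT : ∀ i, MeasurePreserving (T i) μ μ) {ε : ℝ} (hε : 0 < ε) :
    μ {x | ∃ n : ℕ, n * ε < |koopmanSum T n f x|} ≤ ENNReal.ofReal ((∫ x, |f x| ∂μ) / ε) := by
  -- Subtracting ε turns "some sum of |f| exceeds nε" into positivity of some sum of g, to which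
  -- Hopf's lemma applies.
  set g : α → ℝ := |f| - fun _ => ε with hg
  have hgi : Integrable g μ := hf.abs.sub (integrable_const ε)
  have hsub : {x | ∃ n : ℕ, n * ε < |koopmanSum T n f x|} ⊆ ⋃ n, {x | 0 < koopmanMax T g n x} := by
    rintro x ⟨n, hn⟩
    refine Set.mem_iUnion.2 ⟨n, ?_⟩
    have h1 := koopmanSum_le_koopmanMax T g n x
    rw [hg, map_sub, koopmanSum_const] at h1
    have h2 := abs_koopmanSum_le_koopmanSum_abs T f n x
    have h3 : koopmanSum T n |f| x - n * ε ≤ koopmanMax T g n x := h1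
    change 0 < koopmanMax T g n x
    linarith
  have hmono : Monotone fun n => {x | 0 < koopmanMax T g n x} := fun m n hmn x hx =>
    lt_of_lt_of_le hx (koopmanMax_mono T g hmn x)
  refine (measure_mono hsub).trans ?_
  rw [hmono.measure_iUnion]
  refine iSup_le fun n => ?_
  rw [← ofReal_measureReal]
  refine ENNReal.ofReal_le_ofReal ?_
  rw [le_div_iff₀ hε]
  have h := setIntegral_koopmanMax_pos_nonneg hgi hT n
  have h1 : ∫ x in {x | 0 < koopmanMax T g n x}, g x ∂μ
      = ∫ x in {x | 0 < koopmanMax T g n x}, |f x| ∂μ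
        - ∫ _ in {x | 0 < koopmanMax T g n x}, ε ∂μ :=
    integral_sub hf.abs.integrableOn (integrable_const ε)
  have h2 : ∫ x in {x | 0 < koopmanMax T g n x}, |f x| ∂μ ≤ ∫ x, |f x| ∂μ :=
    setIntegral_le_integral hf.abs (Eventually.of_forall fun x => abs_nonneg _)
  rw [setIntegral_const, smul_eq_mul] at h1
  linarith

end AveragedKoopman

/-! ### Mean and pointwise ergodic theorems for the averaged operator. -/

section MeanErgodic

variable {α ι : Type*} [Fintype ι] [MeasurableSpace α] {μ : Measure α} {T : ι → α → α}

/-- The averaged composition operator on `L²`. -/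
def averagedKoopmanLp (hT : ∀ i, MeasurePreserving (T i) μ μ) : Lp ℝ 2 μ →L[ℝ] Lp ℝ 2 μ :=
  (Fintype.card ι : ℝ)⁻¹ •
    ∑ i, (Lp.compMeasurePreservingₗᵢ ℝ (T i) (hT i)).toContinuousLinearMap

theorem averagedKoopmanLp_apply (hT : ∀ i, MeasurePreserving (T i) μ μ) (h : Lp ℝ 2 μ) :
    averagedKoopmanLp hT h
      = (Fintype.card ι : ℝ)⁻¹ • ∑ i, Lp.compMeasurePreserving (T i) (hT i) h := by
  simp [averagedKoopmanLp]
  rfl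

theorem norm_averagedKoopmanLp_le [Nonempty ι] (hT : ∀ i, MeasurePreserving (T i) μ μ) :
    ‖averagedKoopmanLp hT‖ ≤ 1 := by
  refine ContinuousLinearMap.opNorm_le_bound _ zero_le_one fun h => ?_
  have hc : (Fintype.card ι : ℝ) ≠ 0 := by simp
  rw [averagedKoopmanLp_apply, norm_smul]
  calc _ ≤ ‖(Fintype.card ι : ℝ)⁻¹‖ * ∑ i, ‖Lp.compMeasurePreserving (T i) (hT i) h‖ := by
        gcongr
        exact norm_sum_le _ _
    _ = 1 * ‖h‖ := by
        simp only [Lp.norm_compMeasurePreserving]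
        simp [hc]

/-- Strict convexity: with U_i the isometries, ∑ ‖U_i h - h‖² = 2 card ι ‖h‖² - 2⟪∑ U_i h, h⟫, which
vanishes when ∑ U_i h = card ι • h. -/
theorem compMeasurePreserving_eq_of_averagedKoopmanLp_eq [Nonempty ι]
    (hT : ∀ i, MeasurePreserving (T i) μ μ) {h : Lp ℝ 2 μ} (hh : averagedKoopmanLp hT h = h)
    (i : ι) : Lp.compMeasurePreserving (T i) (hT i) h = h := by
  have hc : (Fintype.card ι : ℝ) ≠ 0 := by simp
  have hsum : ∑ i, Lp.compMeasurePreserving (T i) (hT i) h = (Fintype.card ι : ℝ) • h := by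
    rw [averagedKoopmanLp_apply] at hh
    conv_rhs => rw [← hh]
    rw [smul_inv_smul₀ hc]
  have h0 : ∑ i, ‖Lp.compMeasurePreserving (T i) (hT i) h - h‖ ^ 2 = 0 := by
    simp_rw [norm_sub_sq_real, Lp.norm_compMeasurePreserving]
    rw [Finset.sum_add_distrib, Finset.sum_sub_distrib, ← Finset.mul_sum, ← sum_inner, hsum,
      real_inner_smul_left, real_inner_self_eq_norm_sq]
    simp
    ring
  have := (Finset.sum_eq_zero_iff_of_nonneg fun i _ => sq_nonneg _).1 h0 i (Finset.mem_univ i)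
  exact sub_eq_zero.1 (norm_eq_zero.1 (pow_eq_zero_iff two_ne_zero |>.1 this))

theorem averagedKoopmanLp_toLp (hT : ∀ i, MeasurePreserving (T i) μ μ) {f : α → ℝ}
    (hf : MemLp f 2 μ) :
    averagedKoopmanLp hT (hf.toLp f) = (hf.averagedKoopman hT).toLp (averagedKoopman T f) := by
  rw [averagedKoopmanLp_apply]
  simp_rw [Lp.toLp_compMeasurePreserving]
  refine Lp.ext ?_
  refine (Lp.coeFn_smul _ _).trans ?_
  refine EventuallyEq.trans ?_ (MemLp.coeFn_toLp _).symm
  have h1 := Lp.coeFn_finsetSum Finset.univ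
    (fun i => (hf.comp_measurePreserving (hT i)).toLp (f ∘ T i))
  have h2 : ∀ᵐ x ∂μ, ∀ i, (hf.comp_measurePreserving (hT i)).toLp (f ∘ T i) x = f (T i x) :=
    ae_all_iff.2 fun i => MemLp.coeFn_toLp _
  filter_upwards [h1, h2] with x hx1 hx2
  rw [Pi.smul_apply, hx1, Finset.sum_apply, averagedKoopman_apply, smul_eq_mul]
  simp_rw [hx2]

theorem averagedKoopmanLp_iterate_toLp (hT : ∀ i, MeasurePreserving (T i) μ μ) {f : α → ℝ}
    (hf : MemLp f 2 μ) (k : ℕ) :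
    (averagedKoopmanLp hT)^[k] (hf.toLp f)
      = (hf.averagedKoopman_pow hT k).toLp ((averagedKoopman T ^ k) f) := by
  induction k with
  | zero => simp
  | succ k ih =>
    rw [Function.iterate_succ_apply', ih, averagedKoopmanLp_toLp]
    congr 1
    rw [pow_succ']
    rfl

/-- The mean ergodic theorem for the averaged composition operator, when one of the maps is
ergodic. -/
theorem exists_tendsto_eLpNorm_koopmanSum [Nonempty ι] [IsProbabilityMeasure μ]
    (hT : ∀ i, MeasurePreserving (T i) μ μ) {i₀ : ι} (hi₀ : Ergodic (T i₀) μ) {f : α → ℝ}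
    (hf : MemLp f 2 μ) :
    ∃ c : ℝ, Tendsto (fun n : ℕ => eLpNorm ((n : ℝ)⁻¹ • koopmanSum T n f - fun _ => c) 2 μ)
      atTop (𝓝 0) := by
  have hlim := (averagedKoopmanLp hT).tendsto_birkhoffAverage_orthogonalProjection
    (norm_averagedKoopmanLp_le hT) (hf.toLp f)
  set h := ((averagedKoopmanLp hT).eqLocus
    (1 : Lp ℝ 2 μ →L[ℝ] Lp ℝ 2 μ)).orthogonalProjectionOnto (hf.toLp f)
  have hfix : averagedKoopmanLp hT (h : Lp ℝ 2 μ) = h := h.2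
  have hinv := compMeasurePreserving_eq_of_averagedKoopmanLp_eq hT hfix i₀
  have hinv' : (h : Lp ℝ 2 μ) ∘ T i₀ =ᵐ[μ] (h : Lp ℝ 2 μ) := by
    refine (Lp.coeFn_compMeasurePreserving (h : Lp ℝ 2 μ) (hT i₀)).symm.trans ?_
    rw [hinv]
  obtain ⟨c, hc⟩ := hi₀.ae_eq_const_of_ae_eq_comp_ae (Lp.aestronglyMeasurable _) hinv'
  refine ⟨c, ?_⟩
  rw [Lp.tendsto_Lp_iff_tendsto_eLpNorm'] at hlim
  refine hlim.congr fun n => eLpNorm_congr_ae ?_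
  have h1 := Lp.coeFn_smul (n : ℝ)⁻¹
    (∑ k ∈ Finset.range n, (averagedKoopmanLp hT)^[k] (hf.toLp f))
  have h2 := Lp.coeFn_finsetSum (Finset.range n)
    (fun k => (averagedKoopmanLp hT)^[k] (hf.toLp f))
  have h3 : ∀ᵐ x ∂μ, ∀ k, (averagedKoopmanLp hT)^[k] (hf.toLp f) x
      = (averagedKoopman T ^ k) f x := by
    refine ae_all_iff.2 fun k => ?_
    rw [averagedKoopmanLp_iterate_toLp]
    exact MemLp.coeFn_toLp _
  filter_upwards [hc, h1, h2, h3] with x hx hx1 hx2 hx3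
  refine congrArg₂ (· - ·) (hx1.trans ?_) hx
  rw [Pi.smul_apply, hx2, Finset.sum_apply, Pi.smul_apply, koopmanSum_apply, Finset.sum_apply]
  simp_rw [hx3]

/-- Up to an arbitrarily small error in `L¹`, every integrable function is the sum of a constant
and a bounded coboundary of the averaged composition operator. -/
theorem exists_integral_sub_coboundary_le [Nonempty ι] [IsProbabilityMeasure μ]
    (hT : ∀ i, MeasurePreserving (T i) μ μ) {i₀ : ι} (hi₀ : Ergodic (T i₀) μ) {f : α → ℝ}
    (hf : Integrable f μ) {δ : ℝ} (hδ : 0 < δ) :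
    ∃ (c C : ℝ) (g : α → ℝ), Integrable g μ ∧ (∀ x, |g x| ≤ C) ∧
      ∫ x, |f x - c - (g x - averagedKoopman T g x)| ∂μ ≤ δ := by
  have hδ2 : ENNReal.ofReal (δ / 2) ≠ 0 := by simpa using hδ
  -- A simple function is both in L², for the mean ergodic theorem, and bounded, for the bound on g.
  obtain ⟨φ, hφ, -⟩ := (memLp_one_iff_integrable.2 hf).exists_simpleFunc_eLpNorm_sub_lt
    ENNReal.one_ne_top hδ2
  obtain ⟨C, hC⟩ := φ.exists_forall_norm_le
  have hφ2 : MemLp φ 2 μ := φ.memLp_of_isFiniteMeasure 2 μ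
  obtain ⟨c, hc⟩ := exists_tendsto_eLpNorm_koopmanSum hT hi₀ hφ2
  obtain ⟨n, hn, hn1⟩ := ((hc.eventually_lt_const (pos_iff_ne_zero.2 hδ2)).and
    (eventually_ge_atTop 1)).exists
  have hn0 : (n : ℝ) ≠ 0 := by positivity
  set S : α → ℝ := (n : ℝ)⁻¹ • koopmanSum T n φ with hS
  have hS2 : MemLp S 2 μ := (hφ2.koopmanSum hT n).const_smul _
  -- As S_j φ - P S_j φ = φ - P^j φ, averaging over j < n solves g - P g = φ - S exactly.
  set g : α → ℝ := (n : ℝ)⁻¹ • ∑ j ∈ Finset.range n, koopmanSum T j φ with hg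
  have hgint : Integrable g μ := by
    refine Integrable.smul _ (integrable_finsetSum' _ fun j _ => ?_)
    exact (hφ2.koopmanSum hT j).integrable one_le_two
  have hgb (x : α) : |g x| ≤ (n : ℝ)⁻¹ * ∑ j ∈ Finset.range n, j * C := by
    rw [hg, Pi.smul_apply, smul_eq_mul, abs_mul, abs_of_nonneg (by positivity : 0 ≤ (n : ℝ)⁻¹),
      Finset.sum_apply]
    gcongr
    refine (Finset.abs_sum_le_sum_abs _ _).trans (Finset.sum_le_sum fun j _ => ?_)
    exact abs_koopmanSum_le T hC j x
  have hcob : g - averagedKoopman T g = φ - S := by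
    rw [hg, map_smul, map_sum, ← smul_sub, ← Finset.sum_sub_distrib]
    simp_rw [sub_averagedKoopman_koopmanSum]
    rw [Finset.sum_sub_distrib, ← koopmanSum_apply, smul_sub, ← hS]
    congr 1
    simp [← Nat.cast_smul_eq_nsmul ℝ, smul_smul, hn0]
  refine ⟨c, _, g, hgint, hgb, ?_⟩
  have heq (x : α) : f x - c - (g x - averagedKoopman T g x) = (f x - φ x) + (S x - c) := by
    have := congrFun hcob x
    simp only [Pi.sub_apply] at this
    rw [this]
    ring
  have hφi : Integrable φ μ := hφ2.integrable one_le_two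
  have hSi : Integrable S μ := hS2.integrable one_le_two
  have hi1 : Integrable (f - ⇑φ) μ := hf.sub hφi
  have hi2 : Integrable (S - fun _ => c) μ := hSi.sub (integrable_const c)
  have key {u : α → ℝ} (hu : Integrable u μ) (h : eLpNorm u 1 μ < ENNReal.ofReal (δ / 2)) :
      ∫ x, |u x| ∂μ ≤ δ / 2 := by
    have h1 : ∫ x, ‖u x‖ ∂μ = (eLpNorm u 1 μ).toReal := by
      rw [eLpNorm_one_eq_lintegral_enorm, integral_norm_eq_lintegral_enorm hu.1]
    refine (h1.trans_le ?_)
    exact ENNReal.toReal_le_of_le_ofReal (by positivity) h.le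
  have k1 := key hi1 hφ
  have k2 : ∫ x, |S x - c| ∂μ ≤ δ / 2 := key hi2 ((eLpNorm_le_eLpNorm_of_exponent_le one_le_two hi2.1).trans_lt hn)
  calc ∫ x, |f x - c - (g x - averagedKoopman T g x)| ∂μ
      ≤ ∫ x, (|(f - ⇑φ) x| + |S x - c|) ∂μ := by
        refine integral_mono_of_nonneg (Eventually.of_forall fun x => abs_nonneg _)
          (hi1.abs.add hi2.abs) (Eventually.of_forall fun x => ?_)
        simp only [heq]
        exact abs_add_le (f x - φ x) (S x - c)
    _ = ∫ x, |(f - ⇑φ) x| ∂μ + ∫ x, |S x - c| ∂μ := integral_add hi1.abs hi2.abs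
    _ ≤ δ := by linarith

/-- The pointwise ergodic theorem for the averaged composition operator of a finite family of
measure preserving maps, one of which is ergodic. -/
theorem ae_tendsto_koopmanSum [Nonempty ι] [IsProbabilityMeasure μ]
    (hT : ∀ i, MeasurePreserving (T i) μ μ) {i₀ : ι} (hi₀ : Ergodic (T i₀) μ) {f : α → ℝ}
    (hf : Integrable f μ) :
    ∀ᵐ x ∂μ, Tendsto (fun n : ℕ => (n : ℝ)⁻¹ * koopmanSum T n f x) atTop (𝓝 (∫ y, f y ∂μ)) := by
  set I := ∫ y, f y ∂μ with hI
  have main (ε : ℝ) (hε : 0 < ε) :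
      ∀ᵐ x ∂μ, ∀ᶠ n : ℕ in atTop, |(n : ℝ)⁻¹ * koopmanSum T n f x - I| ≤ 3 * ε := by
    -- The exceptional set does not depend on δ, so letting δ → 0 makes it null. The three ε bound
    -- |c - I|, the coboundary term and the remainder r.
    have hbad (δ : ℝ) (hδ : 0 < δ) (hδε : δ ≤ ε) :
        μ {x | ¬ ∀ᶠ n : ℕ in atTop, |(n : ℝ)⁻¹ * koopmanSum T n f x - I| ≤ 3 * ε}
          ≤ ENNReal.ofReal (δ / ε) := by
      obtain ⟨c, C, g, hgi, hgC, hr⟩ := exists_integral_sub_coboundary_le hT hi₀ hf hδ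
      have hPg : Integrable (averagedKoopman T g) μ := hgi.averagedKoopman hT
      set r : α → ℝ := f - (fun _ => c) - (g - averagedKoopman T g) with hrdef
      have hri : Integrable r μ := (hf.sub (integrable_const c)).sub (hgi.sub hPg)
      have hr' : ∫ x, |r x| ∂μ ≤ δ := hr
      -- P preserves integrals, so the coboundary integrates to 0 and c is forced to be close to I.
      have hcI : |c - I| ≤ δ := by
        have h1 : ∫ x, r x ∂μ = I - c := by
          rw [hrdef, integral_sub' (hf.sub (integrable_const c)) (hgi.sub hPg),
            integral_sub' hf (integrable_const c), integral_sub' hgi hPg,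
            integral_averagedKoopman hgi hT]
          simp [hI]
        rw [abs_sub_comm, ← h1]
        exact abs_integral_le_integral_abs.trans hr'
      have hf_eq : f = (fun _ => c) + (g - averagedKoopman T g) + r := by
        rw [hrdef]
        abel
      refine le_trans (measure_mono ?_) ((measure_exists_lt_abs_koopmanSum_le hri hT hε).trans
        (ENNReal.ofReal_le_ofReal (by gcongr)))
      intro x hx
      by_contra hx'
      simp only [Set.mem_ofPred_eq, not_exists, not_lt] at hx'
      refine hx ?_
      have hlim : Tendsto (fun n : ℕ => 2 * C / (n : ℝ)) atTop (𝓝 0) :=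
        tendsto_const_div_atTop_nhds_zero_nat _
      filter_upwards [hlim.eventually_le_const hε, eventually_gt_atTop 0] with n hn hn0
      have hn0' : (0 : ℝ) < n := by exact_mod_cast hn0
      have hsum : koopmanSum T n f x
          = n * c + (g x - (averagedKoopman T ^ n) g x) + koopmanSum T n r x := by
        conv_lhs => rw [hf_eq]
        rw [map_add, map_add, koopmanSum_const, koopmanSum_sub_averagedKoopman]
        rfl
      have e1 : (n : ℝ)⁻¹ * koopmanSum T n f x - I
          = (c - I) + ((g x - (averagedKoopman T ^ n) g x) / n + koopmanSum T n r x / n) := by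
        rw [hsum]
        field_simp
        ring
      have e2 : |(g x - (averagedKoopman T ^ n) g x) / n| ≤ ε := by
        rw [abs_div, abs_of_pos hn0']
        refine le_trans ?_ hn
        gcongr
        have := abs_sub (g x) ((averagedKoopman T ^ n) g x)
        linarith [hgC x, abs_averagedKoopman_pow_le T hgC n x]
      have e3 : |koopmanSum T n r x / n| ≤ ε := by
        rw [abs_div, abs_of_pos hn0', div_le_iff₀ hn0', mul_comm]
        exact hx' n
      rw [e1]
      refine ((abs_add_le _ _).trans (add_le_add_right (abs_add_le _ _) _)).trans ?_
      linarith
    have hlim : Tendsto (fun δ : ℝ => ENNReal.ofReal (δ / ε)) (𝓝[>] 0) (𝓝 0) := by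
      have : Tendsto (fun δ : ℝ => ENNReal.ofReal (δ / ε)) (𝓝 0) (𝓝 (ENNReal.ofReal (0 / ε))) :=
        (ENNReal.continuous_ofReal.comp (continuous_id.div_const ε)).tendsto 0
      simp only [zero_div, ENNReal.ofReal_zero] at this
      exact this.mono_left nhdsWithin_le_nhds
    refine le_antisymm (ge_of_tendsto hlim ?_) zero_le
    filter_upwards [Ioc_mem_nhdsGT hε] with δ hδ
    exact hbad δ hδ.1 hδ.2
  have hall : ∀ᵐ x ∂μ, ∀ m : ℕ, ∀ᶠ n : ℕ in atTop,
      |(n : ℝ)⁻¹ * koopmanSum T n f x - I| ≤ 3 * (1 / ((m : ℝ) + 1)) :=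
    ae_all_iff.2 fun m => main _ Nat.one_div_pos_of_nat
  filter_upwards [hall] with x hx
  rw [Metric.tendsto_nhds]
  intro ε hε
  obtain ⟨m, hm⟩ := exists_nat_one_div_lt (show 0 < ε / 3 by positivity)
  filter_upwards [hx m] with n hn
  rw [Real.dist_eq]
  linarith

end MeanErgodic

/-! ### Ergodicity of the interval maps, by transfer from the circle. -/

section IntervalMap

theorem unitInterval.measurePreserving_coe_unitAddCircle :
    MeasurePreserving (fun x : unitInterval => ((x : ℝ) : UnitAddCircle)) volume volume := by
  have h1 : MeasurePreserving ((↑) : ℝ → UnitAddCircle) (volume.restrict unitInterval) volume := by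
    have := UnitAddCircle.measurePreserving_mk 0
    rwa [zero_add, Measure.restrict_congr_set Ioc_ae_eq_Icc] at this
  exact h1.comp unitInterval.measurePreserving_coe

/-- The representative in `[0, 1)` of a point of the circle, as a point of `[0, 1]`. -/
def UnitAddCircle.toUnitInterval (y : UnitAddCircle) : unitInterval :=
  ⟨AddCircle.measurableEquivIco 1 0 y, (AddCircle.measurableEquivIco 1 0 y).2.1,
    (AddCircle.measurableEquivIco 1 0 y).2.2.le.trans_eq (zero_add 1)⟩

theorem UnitAddCircle.toUnitInterval_coe (x : ℝ) :
    (UnitAddCircle.toUnitInterval (x : UnitAddCircle) : ℝ) = Int.fract x := by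
  have := AddCircle.coe_equivIco_mk_apply (p := (1 : ℝ)) x
  rwa [div_one, mul_one] at this

theorem UnitAddCircle.measurable_toUnitInterval : Measurable UnitAddCircle.toUnitInterval :=
  (measurable_subtype_coe.comp (AddCircle.measurableEquivIco 1 0).measurable).subtype_mk

/-- Projecting [0,1] to the circle preserves measure, and this map undoes the projection except at
the null point 1. -/
theorem UnitAddCircle.measurePreserving_toUnitInterval :
    MeasurePreserving UnitAddCircle.toUnitInterval volume volume := by
  refine ⟨UnitAddCircle.measurable_toUnitInterval, ?_⟩
  have h := unitInterval.measurePreserving_coe_unitAddCircle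
  rw [← h.map_eq, Measure.map_map UnitAddCircle.measurable_toUnitInterval h.measurable]
  conv_rhs => rw [← Measure.map_id (μ := (volume : Measure unitInterval))]
  refine Measure.map_congr ?_
  have hne : ∀ᵐ x : unitInterval, x ≠ 1 := by
    simp [ae_iff]
  filter_upwards [hne] with x hx
  refine Subtype.ext ?_
  have hx1 : (x : ℝ) < 1 := lt_of_le_of_ne x.2.2 fun h => hx (Subtype.ext h)
  exact (UnitAddCircle.toUnitInterval_coe x).trans (Int.fract_eq_self.2 ⟨x.2.1, hx1⟩)

theorem measurable_intervalMap (d : ℕ) : Measurable (intervalMap d) :=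
  (measurable_fract.comp (measurable_subtype_coe.const_mul ((d : ℝ) + 1))).subtype_mk

/-- `intervalMap d` is a factor, through `UnitAddCircle.toUnitInterval`, of multiplication by d + 1
≥ 2 on the circle. -/
theorem ergodic_intervalMap {d : ℕ} (hd : 1 ≤ d) : Ergodic (intervalMap d) volume := by
  refine UnitAddCircle.measurePreserving_toUnitInterval.ergodic_of_ergodic_semiconj
    (AddCircle.ergodic_nsmul (T := 1) (n := d + 1) (by lia)) (measurable_intervalMap d) fun y => ?_
  induction y using QuotientAddGroup.induction_on with
  | H x =>
    refine Subtype.ext ?_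
    change (UnitAddCircle.toUnitInterval ((d + 1) • (x : UnitAddCircle)) : ℝ)
      = Int.fract (((d : ℝ) + 1) * (UnitAddCircle.toUnitInterval (x : UnitAddCircle) : ℝ))
    rw [← AddCircle.coe_nsmul, UnitAddCircle.toUnitInterval_coe, UnitAddCircle.toUnitInterval_coe,
      Int.fract_eq_fract]
    refine ⟨(d + 1) * ⌊x⌋, ?_⟩
    have := Int.self_sub_floor x
    push_cast
    rw [← this, nsmul_eq_mul]
    push_cast
    ring

/-! ### Sums over words as powers of the averaged operator. -/

theorem sum_wordMap_succ {N n : ℕ} (f : unitInterval → ℝ) (x : unitInterval) :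
    ∑ w : Fin (n + 1) → Letter N, f (wordMap w x)
      = ∑ v : Fin n → Letter N, ∑ d : Letter N, f (intervalMap d (wordMap v x)) := by
  rw [← (Fin.snocEquiv fun _ => Letter N).sum_comp, Fintype.sum_prod_type_right]
  simp [Fin.snocEquiv, wordMap]

theorem sum_wordMap_eq {N : ℕ} (hN : 1 ≤ N) (n : ℕ) (f : unitInterval → ℝ) (x : unitInterval) :
    ∑ w : Fin n → Letter N, f (wordMap w x)
      = (N : ℝ) ^ n * (averagedKoopman (fun d : Letter N => intervalMap d) ^ n) f x := by
  have hN0 : (N : ℝ) ≠ 0 := by positivity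
  induction n generalizing f with
  | zero => simp [wordMap]
  | succ n ih =>
    have h (y : unitInterval) : ∑ d : Letter N, f (intervalMap d y)
        = N * averagedKoopman (fun d : Letter N => intervalMap d) f y := by
      rw [averagedKoopman_apply]
      simp [hN0]
    simp_rw [sum_wordMap_succ, h]
    rw [← Finset.mul_sum, ih, pow_succ (averagedKoopman _)]
    simp only [Module.End.mul_apply]
    ring

/-- The sum along a word uses only its proper prefixes, so the appended letter d never acts; the new
term comes from the whole of v. -/
theorem ergodicSum_snoc {N n : ℕ} (v : Fin n → Letter N) (d : Letter N) (f : unitInterval → ℝ)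
    (x : unitInterval) :
    ergodicSum (Fin.snoc (α := fun _ => Letter N) v d) f x
      = ergodicSum v f x + f (wordMap v x) := by
  have h (k : ℕ) (hk : k ≤ n) :
      Fin.take k (hk.trans n.le_succ) (Fin.snoc (α := fun _ => Letter N) v d)
        = Fin.take k hk v := by
    rw [← Fin.take_init (α := fun _ => Letter N), Fin.init_snoc]
  rw [ergodicSum, Fin.sum_univ_castSucc]
  congr 1
  · refine Finset.sum_congr rfl fun k _ => ?_
    exact congrArg (fun u => compOp u f x) (h k k.2.le)
  · exact congrArg (fun u => compOp u f x) ((h n le_rfl).trans (Fin.take_eq_self v))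

theorem sum_ergodicSum_eq {N : ℕ} (hN : 1 ≤ N) (n : ℕ) (f : unitInterval → ℝ) (x : unitInterval) :
    ∑ w : Fin n → Letter N, ergodicSum w f x
      = (N : ℝ) ^ n * koopmanSum (fun d : Letter N => intervalMap d) n f x := by
  induction n with
  | zero => simp [ergodicSum, koopmanSum]
  | succ n ih =>
    rw [← (Fin.snocEquiv fun _ => Letter N).sum_comp, Fintype.sum_prod_type_right]
    simp only [Fin.snocEquiv, Equiv.coe_fn_mk, ergodicSum_snoc, Finset.sum_const, Finset.card_univ,
      Fintype.card_coe, Nat.card_Icc, add_tsub_cancel_right, nsmul_eq_mul]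
    rw [← Finset.mul_sum, Finset.sum_add_distrib, ih, sum_wordMap_eq hN, koopmanSum_apply,
      koopmanSum_apply, Finset.sum_range_succ, Pi.add_apply]
    ring

end IntervalMap

end

theorem mainTheorem2 (N : ℕ) (hN : 1 ≤ N) (f : unitInterval → ℝ)
    (hf : Integrable f (volume : Measure unitInterval)) :
    ∀ᵐ x ∂(volume : Measure unitInterval),
      Tendsto (fun n : ℕ =>
          (1 / (n : ℝ)) * (1 / (N : ℝ) ^ n) * ∑ w : Fin n → Letter N, ergodicSum w f x)
        atTop (𝓝 (∫ y, f y ∂(volume : Measure unitInterval))) := by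
  have : Nonempty (Letter N) := ⟨⟨1, Finset.mem_Icc.2 ⟨le_rfl, hN⟩⟩⟩
  have herg (d : Letter N) : Ergodic (intervalMap d) volume :=
    ergodic_intervalMap (Finset.mem_Icc.1 d.2).1
  have hN0 : (N : ℝ) ≠ 0 := by positivity
  filter_upwards [ae_tendsto_koopmanSum (T := fun d : Letter N => intervalMap d)
    (fun d => (herg d).toMeasurePreserving) (herg (Classical.arbitrary _)) hf] with x hx
  refine hx.congr fun n => ?_
  rw [sum_ergodicSum_eq hN]
  field_simp
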